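/- Let $p>3$ be a prime number. Then \[ \sum_{k=0}^{p-1}\frac{1}{2^{8k}3^{2k}}\sum_{j=0}^{k}\binom{2j}{j}^2\binom{4j}{2j}\binom{2k-2j}{k-j}^2\binom{4k-4j}{2k-2j}(8j+1)(8k-8j+1)\equiv p^2 \pmod{p^3}. \] Here, for rational numbers $x,y$ and an integer $m$, the congruence $x\equiv y\pmod m$ means that $x-y=a/b$ for some integers $a,b$ with $b\neq 0$, $m\mid a$ and $\gcd(m,b)=1$. -/

import Mathlib

/-- Congruence of rational numbers modulo an integer `m`: the difference `x - y` can be written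
as a fraction `a / b` of integers whose numerator is divisible by `m` and whose denominator is
nonzero and coprime to `m`. -/
def RatModEq (m : ℤ) (x y : ℚ) : Prop :=
  ∃ a b : ℤ, b ≠ 0 ∧ IsCoprime m b ∧ m ∣ a ∧ x - y = (a : ℚ) / (b : ℚ)

/-! Write S(x) for the sum of `cubicTerm x k` over k < p. The double sum is the part i + j < p of
S(0)². The other products vanish mod p³, since `cubicTerm 0 k` is divisible by p to the power ⌊4k/p⌋
(`padicDvd_convolution_sub`). As x enters only through x², S(0) ≡ S(p) mod p². A WZ pair shows that
S(x)/x is unchanged under x ↦ x + 6 when the boundary term vanishes (`sum_cubicTerm_add_six`), so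
S(p) = ±p. Then S(0)² - p² = (S(0) - S(p))(S(0) + S(p)) is divisible by p² · p. -/

/-- The normalized central binomial coefficient `C(4k, 2k) / 16 ^ k`. -/
def normChoose (k : ℕ) : ℚ := ((4 * k).choose (2 * k) : ℚ) / 16 ^ k

theorem normChoose_succ (k : ℕ) :
    normChoose (k + 1) =
      normChoose k * ((4 * k + 1) * (4 * k + 3) / ((4 * k + 2) * (4 * k + 4))) := by
  have h1 := Nat.succ_mul_centralBinom_succ (2 * k)
  have h2 := Nat.succ_mul_centralBinom_succ (2 * k + 1)
  have e0 : (4 * k).choose (2 * k) = (2 * k).centralBinom := by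
    rw [Nat.centralBinom]; congr 1; ring
  have e1 : (4 * (k + 1)).choose (2 * (k + 1)) = (2 * k + 1 + 1).centralBinom := by
    rw [Nat.centralBinom]; congr 1; ring
  have h1' : ((2 * k + 1 : ℚ)) * ((2 * k + 1).centralBinom : ℚ) =
      2 * (2 * (2 * k) + 1) * ((2 * k).centralBinom : ℚ) := by exact_mod_cast h1
  have h2' : ((2 * k + 1 + 1 : ℚ)) * ((2 * k + 1 + 1).centralBinom : ℚ) =
      2 * (2 * (2 * k + 1) + 1) * ((2 * k + 1).centralBinom : ℚ) := by exact_mod_cast h2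
  have p1 : (2 * k + 1 : ℚ) ≠ 0 := by positivity
  have p2 : (2 * k + 1 + 1 : ℚ) ≠ 0 := by positivity
  have h1'' := eq_div_of_mul_eq p1 ((mul_comm _ _).trans h1')
  have h2'' := eq_div_of_mul_eq p2 ((mul_comm _ _).trans h2')
  rw [normChoose, normChoose, e0, e1, h2'', h1'', pow_succ]
  have p3 : (4 * k + 2 : ℚ) ≠ 0 := by positivity
  have p4 : (4 * k + 4 : ℚ) ≠ 0 := by positivity
  field_simp
  ring

/-- The summand of the terminating cubic hypergeometric sum with parameter `x`; at `x = 0` it is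
the summand of Ramanujan's series for `2√3 / π`. -/
def cubicTerm (x : ℚ) (k : ℕ) : ℚ :=
  (8 * k + 1) * normChoose k *
    ∏ i ∈ Finset.range k, ((2 * i + 1) ^ 2 - x ^ 2) / (36 * (i + 1) ^ 2 - x ^ 2)

/-- The common hypergeometric factor of `cubicTerm x` and `cubicTerm (x + 6)`. -/
def cubicKernel (x : ℚ) (k : ℕ) : ℚ :=
  normChoose k *
    ∏ i ∈ Finset.range k, (2 * i - 5 - x) * (2 * i + 1 + x) / (36 * (i + 1) ^ 2 - x ^ 2)

theorem cubicKernel_succ (x : ℚ) (k : ℕ) :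
    cubicKernel x (k + 1) = cubicKernel x k *
      ((4 * k + 1) * (4 * k + 3) / ((4 * k + 2) * (4 * k + 4)) *
        ((2 * k - 5 - x) * (2 * k + 1 + x) / (36 * (k + 1) ^ 2 - x ^ 2))) := by
  simp only [cubicKernel, normChoose_succ, Finset.prod_range_succ]
  ring

/-- The WZ mate of `cubicTerm`. -/
def cubicMate (x : ℚ) (k : ℕ) : ℚ :=
  16 / (x * (x + 1) * (x + 5)) * (k * (2 * k - 1) * (6 * k - x)) * cubicKernel x k

/-! ### The WZ relation between parameters x and x + 6. -/

section WZ

variable {x : ℚ} (h1 : x + 1 ≠ 0) (h3 : x + 3 ≠ 0) (h5 : x + 5 ≠ 0)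
  (hsub : ∀ k : ℕ, 6 * (k : ℚ) - x ≠ 0) (hadd : ∀ k : ℕ, 6 * (k : ℚ) + x ≠ 0)

-- The quotient of the products of 2i+1-x and 2i-5-x telescopes with step three, leaving three end
-- factors.
include h1 h3 h5 in
theorem prod_eq_kernel (k : ℕ) :
    ∏ i ∈ Finset.range k, ((2 * (i : ℚ) + 1) ^ 2 - x ^ 2) / (36 * (i + 1) ^ 2 - x ^ 2) =
      (∏ i ∈ Finset.range k,
        (2 * (i : ℚ) - 5 - x) * (2 * i + 1 + x) / (36 * (i + 1) ^ 2 - x ^ 2)) *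
      (-((2 * k - 5 - x) * (2 * k - 3 - x) * (2 * k - 1 - x)) /
        ((x + 1) * (x + 3) * (x + 5))) := by
  induction k with
  | zero =>
    simp only [Finset.range_zero, Finset.prod_empty]
    field_simp
    push_cast
    ring
  | succ k ih =>
    rw [Finset.prod_range_succ, Finset.prod_range_succ, ih]
    push_cast
    ring

include h1 h3 h5 hsub hadd in
theorem prod_shift_eq_kernel (k : ℕ) :
    ∏ i ∈ Finset.range k,
        ((2 * (i : ℚ) + 1) ^ 2 - (x + 6) ^ 2) / (36 * (i + 1) ^ 2 - (x + 6) ^ 2) =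
      (∏ i ∈ Finset.range k,
        (2 * (i : ℚ) - 5 - x) * (2 * i + 1 + x) / (36 * (i + 1) ^ 2 - x ^ 2)) *
      (((2 * k + 1 + x) * (2 * k + 3 + x) * (2 * k + 5 + x)) /
        ((x + 1) * (x + 3) * (x + 5)) * ((6 * k - x) * (6 + x) / (-x * (6 * (k + 1) + x)))) := by
  have hx : x ≠ 0 := by simpa using hadd 0
  have h6 : 6 + x ≠ 0 := by simpa using hadd 1
  induction k with
  | zero =>
    simp only [Finset.range_zero, Finset.prod_empty]
    push_cast
    rw [zero_add, mul_one]
    field_simp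
    ring
  | succ k ih =>
    rw [Finset.prod_range_succ, Finset.prod_range_succ, ih]
    have a1 := hsub k
    have a2 : 6 * ((k : ℚ) + 1) + x ≠ 0 := by
      have := hadd (k + 1); push_cast at this; exact this
    have a3 : 6 * ((k : ℚ) + 1 + 1) + x ≠ 0 := by
      have := hadd (k + 2); push_cast at this; intro h; apply this; linarith
    have a5 : 36 * ((k : ℚ) + 1) ^ 2 - (x + 6) ^ 2 = (6 * k - x) * (6 * (k + 1 + 1) + x) := by
      -- The shifted denominator factors are those of the kernel moved by one index in opposite
      -- directions, so their quotient telescopes too.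
      ring
    have a6 : 36 * ((k : ℚ) + 1) ^ 2 - x ^ 2 = (6 * (k + 1) - x) * (6 * (k + 1) + x) := by
      ring
    have a7 : 6 * ((k : ℚ) + 1) - x ≠ 0 := by
      have := hsub (k + 1); push_cast at this; exact this
    rw [a5, a6]
    push_cast
    generalize (∏ i ∈ Finset.range k,
        (2 * (i : ℚ) - 5 - x) * (2 * i + 1 + x) / (36 * (i + 1) ^ 2 - x ^ 2)) = P
    generalize 6 * (k : ℚ) - x = y at a1 ⊢
    field_simp
    ring

include h1 h3 h5 hsub hadd in
theorem cubicTerm_wz (k : ℕ) :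
    cubicTerm (x + 6) k / (x + 6) - cubicTerm x k / x = cubicMate x (k + 1) - cubicMate x k := by
  have hx : x ≠ 0 := by simpa using hadd 0
  have h6 : x + 6 ≠ 0 := by simpa [add_comm] using hadd 1
  have e1 : cubicTerm x k = (8 * k + 1) * (cubicKernel x k *
      (-((2 * k - 5 - x) * (2 * k - 3 - x) * (2 * k - 1 - x)) /
        ((x + 1) * (x + 3) * (x + 5)))) := by
    rw [cubicTerm, prod_eq_kernel h1 h3 h5, cubicKernel]; ring
  have e2 : cubicTerm (x + 6) k = (8 * k + 1) * (cubicKernel x k *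
      (((2 * k + 1 + x) * (2 * k + 3 + x) * (2 * k + 5 + x)) /
        ((x + 1) * (x + 3) * (x + 5)) *
        ((6 * k - x) * (x + 6) / (-x * (6 * (k + 1) + x))))) := by
    rw [cubicTerm, prod_shift_eq_kernel h1 h3 h5 hsub hadd, cubicKernel]; ring
  rw [e1, e2, cubicMate, cubicMate, cubicKernel_succ]
  have a2 : 6 * ((k : ℚ) + 1) + x ≠ 0 := by
    have := hadd (k + 1); push_cast at this; exact this
  have a6 : 36 * ((k : ℚ) + 1) ^ 2 - x ^ 2 = (6 * (k + 1) - x) * (6 * (k + 1) + x) := by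
    ring
  have a7 : 6 * ((k : ℚ) + 1) - x ≠ 0 := by
    have := hsub (k + 1); push_cast at this; exact this
  rw [a6]
  push_cast
  generalize cubicKernel x k = P
  have a8 : (k : ℚ) + 1 ≠ 0 := by positivity
  have a9 : 2 * (k : ℚ) + 1 ≠ 0 := by positivity
  have b1 : 4 * (k : ℚ) + 2 = 2 * (2 * k + 1) := by ring
  have b2 : 4 * (k : ℚ) + 4 = 4 * (k + 1) := by ring
  rw [b1, b2]
  field_simp
  ring

include h1 h3 h5 hsub hadd in
theorem sum_cubicTerm_shift (K : ℕ) :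
    (∑ k ∈ Finset.range K, cubicTerm (x + 6) k) / (x + 6) -
      (∑ k ∈ Finset.range K, cubicTerm x k) / x = cubicMate x K := by
  rw [Finset.sum_div, Finset.sum_div, ← Finset.sum_sub_distrib,
    Finset.sum_congr rfl fun k _ => cubicTerm_wz h1 h3 h5 hsub hadd k, Finset.sum_range_sub]
  simp [cubicMate]

end WZ

/-! ### Evaluation of the terminating sums. -/

theorem cubicMate_eq_zero {x : ℚ} {i k : ℕ} (hi : i < k) (h : 2 * (i : ℚ) = x + 5) :
    cubicMate x k = 0 := by
  have : ∏ i ∈ Finset.range k,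
      (2 * (i : ℚ) - 5 - x) * (2 * i + 1 + x) / (36 * (i + 1) ^ 2 - x ^ 2) = 0 := by
    refine Finset.prod_eq_zero (Finset.mem_range.2 hi) ?_
    rw [h]; simp
  simp [cubicMate, cubicKernel, this]

theorem cubicTerm_eq_zero {x : ℚ} {i k : ℕ} (hi : i < k) (h : 2 * (i : ℚ) + 1 = x) :
    cubicTerm x k = 0 := by
  have : ∏ i ∈ Finset.range k,
      ((2 * (i : ℚ) + 1) ^ 2 - x ^ 2) / (36 * (i + 1) ^ 2 - x ^ 2) = 0 := by
    refine Finset.prod_eq_zero (Finset.mem_range.2 hi) ?_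
    rw [h]; simp
  simp [cubicTerm, this]

theorem sum_cubicTerm_add_six {n i K : ℕ} (hn : n % 6 = 1 ∨ n % 6 = 5) (hi : i < K)
    (h : 2 * i = n + 5) :
    (∑ k ∈ Finset.range K, cubicTerm ((n + 6 : ℕ) : ℚ) k) / ((n + 6 : ℕ) : ℚ) =
      (∑ k ∈ Finset.range K, cubicTerm n k) / n := by
  have key := sum_cubicTerm_shift (x := n) (by positivity) (by positivity) (by positivity)
    (fun k hk => by
      have : 6 * k = n := by exact_mod_cast sub_eq_zero.1 hk
      omega)
    (fun k hk => by
      have : 6 * k + n = 0 := by exact_mod_cast hk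
      omega) K
  rw [cubicMate_eq_zero hi (by exact_mod_cast h)] at key
  push_cast
  exact sub_eq_zero.1 key

theorem sum_cubicTerm_one_mod_six (r : ℕ) {K : ℕ} (hK : 3 * r < K) :
    (∑ k ∈ Finset.range K, cubicTerm ((6 * r + 1 : ℕ) : ℚ) k) / ((6 * r + 1 : ℕ) : ℚ) = 1 := by
  induction r with
  | zero =>
    rw [Finset.sum_eq_single_of_mem 0 (by simpa using hK)
      fun k _ hk => cubicTerm_eq_zero (i := 0) (by omega) (by simp)]
    simp [cubicTerm, normChoose]
  | succ r ih =>
    rw [← ih (by omega)]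
    exact sum_cubicTerm_add_six (n := 6 * r + 1) (i := 3 * r + 3) (by omega) (by omega) (by ring)

theorem sum_cubicTerm_five_mod_six (r : ℕ) {K : ℕ} (hK : 3 * r + 2 < K) :
    (∑ k ∈ Finset.range K, cubicTerm ((6 * r + 5 : ℕ) : ℚ) k) / ((6 * r + 5 : ℕ) : ℚ) = -1 := by
  induction r with
  | zero =>
    -- At parameter 5 the factor with i = 2 vanishes, so only three terms survive.
    have hs : Finset.range 3 ⊆ Finset.range K := Finset.range_subset_range.2 (by omega)
    rw [← Finset.sum_subset hs fun k _ hk => cubicTerm_eq_zero (i := 2)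
      (by rw [Finset.mem_range] at hk; omega) (by norm_num)]
    norm_num [Finset.sum_range_succ, Finset.prod_range_succ, cubicTerm, normChoose, Nat.choose]
  | succ r ih =>
    rw [← ih (by omega)]
    exact sum_cubicTerm_add_six (n := 6 * r + 5) (i := 3 * r + 5) (by omega) (by omega) (by ring)

/-! ### Divisibility by powers of p. -/

theorem pow_dvd_factorial_mul {p : ℕ} (hp : 0 < p) (v : ℕ) : p ^ v ∣ (p * v).factorial := by
  induction v with
  | zero => simp
  | succ v ih =>
    rw [pow_succ, mul_add_one]
    exact (mul_dvd_mul ih (Nat.dvd_factorial hp le_rfl)).trans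
      (Nat.factorial_mul_factorial_dvd_factorial_add _ _)

theorem choose_sq_mul_choose_mul_factorial (k : ℕ) :
    (2 * k).choose k ^ 2 * (4 * k).choose (2 * k) * k.factorial ^ 4 = (4 * k).factorial := by
  have h1 := Nat.choose_mul_factorial_mul_factorial (n := 2 * k) (k := k) (by omega)
  have h2 := Nat.choose_mul_factorial_mul_factorial (n := 4 * k) (k := 2 * k) (by omega)
  rw [show 2 * k - k = k by omega] at h1
  rw [show 4 * k - 2 * k = 2 * k by omega, ← h1] at h2
  rw [← h2]
  ring

/-- Multiplying by k!⁴, which is prime to p, gives (4k)!. -/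
theorem pow_dvd_choose_sq_mul_choose {p k : ℕ} (hp : p.Prime) (hk : k < p) :
    p ^ (4 * k / p) ∣ (2 * k).choose k ^ 2 * (4 * k).choose (2 * k) := by
  have hcop : (p ^ (4 * k / p)).Coprime (k.factorial ^ 4) :=
    Nat.Coprime.pow _ _ ((Nat.Prime.coprime_iff_not_dvd hp).2 fun h =>
      absurd ((hp.dvd_factorial).1 h) (by omega))
  refine hcop.dvd_of_dvd_mul_right ?_
  rw [choose_sq_mul_choose_mul_factorial]
  exact (pow_dvd_factorial_mul hp.pos _).trans
    (Nat.factorial_dvd_factorial (Nat.mul_div_le _ _))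

/-- The rational number `x` is `p ^ m` times a fraction with denominator not divisible by `p`. -/
def PadicDvd (p m : ℕ) (x : ℚ) : Prop :=
  ∃ a b : ℤ, ¬ (p : ℤ) ∣ b ∧ x = (p : ℚ) ^ m * (a / b)

namespace PadicDvd

variable {p m n : ℕ} {x y : ℚ}

theorem cast_ne_zero {b : ℤ} (hb : ¬ (p : ℤ) ∣ b) : (b : ℚ) ≠ 0 := by
  rintro h
  exact hb (by simp [Int.cast_eq_zero.1 h])

theorem of_int (hp : p.Prime) {a : ℤ} (h : (p : ℤ) ^ m ∣ a) : PadicDvd p m a := by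
  obtain ⟨c, rfl⟩ := h
  refine ⟨c, 1, fun h => hp.one_lt.ne' ?_, by simp⟩
  exact_mod_cast Int.eq_one_of_dvd_one (by positivity) h

theorem inv_int {b : ℤ} (hb : ¬ (p : ℤ) ∣ b) : PadicDvd p 0 (b : ℚ)⁻¹ :=
  ⟨1, b, hb, by simp⟩

theorem zero (hp : p.Prime) : PadicDvd p m 0 := by
  simpa using of_int hp (dvd_zero ((p : ℤ) ^ m))

theorem add (hp : p.Prime) (hx : PadicDvd p m x) (hy : PadicDvd p m y) :
    PadicDvd p m (x + y) := by
  obtain ⟨a, b, hb, rfl⟩ := hx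
  obtain ⟨c, d, hd, rfl⟩ := hy
  have := cast_ne_zero hb
  have := cast_ne_zero hd
  refine ⟨a * d + c * b, b * d, (Nat.prime_iff_prime_int.1 hp).not_dvd_mul hb hd, ?_⟩
  push_cast
  field_simp

theorem neg (hx : PadicDvd p m x) : PadicDvd p m (-x) := by
  obtain ⟨a, b, hb, rfl⟩ := hx
  exact ⟨-a, b, hb, by push_cast; ring⟩

theorem sub (hp : p.Prime) (hx : PadicDvd p m x) (hy : PadicDvd p m y) :
    PadicDvd p m (x - y) := by
  rw [sub_eq_add_neg]
  exact hx.add hp hy.neg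

theorem mul (hp : p.Prime) (hx : PadicDvd p m x) (hy : PadicDvd p n y) :
    PadicDvd p (m + n) (x * y) := by
  obtain ⟨a, b, hb, rfl⟩ := hx
  obtain ⟨c, d, hd, rfl⟩ := hy
  refine ⟨a * c, b * d, (Nat.prime_iff_prime_int.1 hp).not_dvd_mul hb hd, ?_⟩
  rw [pow_add]
  push_cast
  rw [mul_div_mul_comm]
  ring

theorem mono (hx : PadicDvd p m x) (h : n ≤ m) : PadicDvd p n x := by
  obtain ⟨a, b, hb, rfl⟩ := hx
  obtain ⟨c, rfl⟩ := Nat.exists_eq_add_of_le h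
  exact ⟨p ^ c * a, b, hb, by push_cast; ring⟩

theorem sum {ι : Type*} (hp : p.Prime) (s : Finset ι) {f : ι → ℚ}
    (h : ∀ i ∈ s, PadicDvd p m (f i)) : PadicDvd p m (∑ i ∈ s, f i) :=
  Finset.sum_induction f (PadicDvd p m) (fun _ _ => add hp) (zero hp) h

theorem prod_sub_prod (hp : p.Prime) {f g : ℕ → ℚ} (k : ℕ)
    (hf : ∀ i < k, PadicDvd p 0 (f i)) (hfg : ∀ i < k, PadicDvd p m (f i - g i)) :
    PadicDvd p 0 (∏ i ∈ Finset.range k, f i) ∧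
      PadicDvd p m (∏ i ∈ Finset.range k, f i - ∏ i ∈ Finset.range k, g i) := by
  induction k with
  | zero =>
    refine ⟨?_, by simpa using zero hp⟩
    simpa using of_int (m := 0) hp (a := 1) (by simp)
  | succ k ih =>
    obtain ⟨h1, h2⟩ := ih (fun i hi => hf i (by omega)) (fun i hi => hfg i (by omega))
    have hfk := hf k (by omega)
    have hd := hfg k (by omega)
    have hg : PadicDvd p 0 (g k) := by
      simpa using hfk.sub hp (hd.mono (Nat.zero_le _))
    rw [Finset.prod_range_succ, Finset.prod_range_succ]
    refine ⟨by simpa using h1.mul hp hfk, ?_⟩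
    -- Uses Ff - Gg = F(f - g) + (F - G)g.
    have key := (h1.mul hp hd).add hp (by simpa using h2.mul hp hg)
    convert key using 1
    · simp
    · ring

theorem ratModEq (hp : p.Prime) (h : PadicDvd p m (x - y)) : RatModEq ((p : ℤ) ^ m) x y := by
  obtain ⟨a, b, hb, e⟩ := h
  refine ⟨p ^ m * a, b, fun h => hb (by simp [h]), ?_, dvd_mul_right _ _, ?_⟩
  · exact IsCoprime.pow_left ((Nat.prime_iff_prime_int.1 hp).coprime_iff_not_dvd.2 hb)
  · rw [e]; push_cast; ring

end PadicDvd

theorem cubicTerm_zero (k : ℕ) :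
    cubicTerm 0 k =
      (8 * k + 1) * ((2 * k).choose k ^ 2 * (4 * k).choose (2 * k)) / 2304 ^ k := by
  have h : ∏ i ∈ Finset.range k, ((2 * (i : ℚ) + 1) ^ 2 - 0 ^ 2) / (36 * (i + 1) ^ 2 - 0 ^ 2) =
      ((2 * k).choose k : ℚ) ^ 2 / 144 ^ k := by
    induction k with
    | zero => simp
    | succ k ih =>
      have h1 : ((k : ℚ) + 1) * ((2 * (k + 1)).choose (k + 1) : ℚ) =
          2 * (2 * k + 1) * ((2 * k).choose k : ℚ) := by
        exact_mod_cast Nat.succ_mul_centralBinom_succ k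
      have p1 : (k : ℚ) + 1 ≠ 0 := by positivity
      rw [Finset.prod_range_succ, ih, eq_div_of_mul_eq p1 ((mul_comm _ _).trans h1), pow_succ]
      simp only [zero_pow two_ne_zero, sub_zero]
      field_simp
      ring
  rw [cubicTerm, h, normChoose, show (2304 : ℚ) = 16 * 144 by norm_num, mul_pow]
  field_simp

/-! ### Congruences modulo p² and p³. -/

section Congruence

variable {p : ℕ} (hp : p.Prime) (hp3 : 3 < p)

include hp hp3 in
theorem not_dvd_two_pow_mul_three_pow (a b : ℕ) : ¬ (p : ℤ) ∣ 2 ^ a * 3 ^ b := by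
  intro h
  have h' : p ∣ 2 ^ a * 3 ^ b := by exact_mod_cast h
  rcases (hp.dvd_mul).1 h' with h | h
  · exact absurd (Nat.le_of_dvd two_pos (hp.dvd_of_dvd_pow h)) (by omega)
  · exact absurd (Nat.le_of_dvd three_pos (hp.dvd_of_dvd_pow h)) (by omega)

include hp hp3 in
theorem padicDvd_inv_two_pow_mul_three_pow (a b : ℕ) :
    PadicDvd p 0 ((2 : ℚ) ^ a * 3 ^ b)⁻¹ := by
  have := PadicDvd.inv_int (not_dvd_two_pow_mul_three_pow hp hp3 a b)
  simpa using this

include hp hp3 in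
theorem padicDvd_cubicTerm_zero {k : ℕ} (hk : k < p) :
    PadicDvd p (4 * k / p) (cubicTerm 0 k) := by
  rw [cubicTerm_zero]
  have h1 : PadicDvd p (4 * k / p)
      (((8 * k + 1 : ℤ) * ((2 * k).choose k ^ 2 * (4 * k).choose (2 * k) : ℕ) : ℤ) : ℚ) := by
    refine PadicDvd.of_int hp (Dvd.dvd.mul_left ?_ _)
    exact_mod_cast pow_dvd_choose_sq_mul_choose hp hk
  have h2 := h1.mul hp (padicDvd_inv_two_pow_mul_three_pow hp hp3 (8 * k) (2 * k))
  rw [add_zero] at h2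
  convert h2 using 1
  rw [pow_mul, pow_mul, ← mul_pow, div_eq_mul_inv]
  norm_num

include hp hp3 in
theorem not_dvd_six_mul {i : ℕ} (hi : i + 1 < p) : ¬ (p : ℤ) ∣ 6 * (i + 1) := by
  intro h
  have h' : p ∣ 2 * 3 * (i + 1) := by exact_mod_cast h
  rcases (hp.dvd_mul).1 h' with h | h
  · rcases (hp.dvd_mul).1 h with h | h
    · exact absurd (Nat.le_of_dvd two_pos h) (by omega)
    · exact absurd (Nat.le_of_dvd three_pos h) (by omega)
  · exact absurd (Nat.le_of_dvd (Nat.succ_pos i) h) (by omega)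

include hp hp3 in
theorem padicDvd_factor_sub {i : ℕ} (hi : i + 1 < p) :
    PadicDvd p 0 (((2 * (i : ℚ) + 1) ^ 2 - 0 ^ 2) / (36 * (i + 1) ^ 2 - 0 ^ 2)) ∧
    PadicDvd p 2 (((2 * (i : ℚ) + 1) ^ 2 - 0 ^ 2) / (36 * (i + 1) ^ 2 - 0 ^ 2) -
      ((2 * (i : ℚ) + 1) ^ 2 - (p : ℚ) ^ 2) / (36 * (i + 1) ^ 2 - (p : ℚ) ^ 2)) := by
  have hprime := Nat.prime_iff_prime_int.1 hp
  have h6 := not_dvd_six_mul hp hp3 hi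
  have hA : ¬ (p : ℤ) ∣ (6 * (i + 1)) ^ 2 := fun h => h6 (hprime.dvd_of_dvd_pow h)
  have hB : ¬ (p : ℤ) ∣ (6 * (i + 1)) ^ 2 - (p : ℤ) ^ 2 := fun h =>
    hA ((dvd_sub_left (dvd_pow_self _ two_ne_zero)).1 h)
  have hA0 := PadicDvd.cast_ne_zero hA
  have hB0 := PadicDvd.cast_ne_zero hB
  push_cast at hA0 hB0
  rw [show (36 : ℚ) * (i + 1) ^ 2 - 0 ^ 2 = (6 * (i + 1)) ^ 2 by ring,
    show (36 : ℚ) * (i + 1) ^ 2 - p ^ 2 = (6 * (i + 1)) ^ 2 - p ^ 2 by ring]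
  -- With a = (2i+1)² and B = (6(i+1))², cross-multiplying gives a(B - p²) - B(a - p²) = p²(B - a).
  refine ⟨⟨(2 * i + 1) ^ 2, _, hA, by push_cast; ring⟩,
    ⟨(6 * (i + 1)) ^ 2 - (2 * i + 1) ^ 2, _, hprime.not_dvd_mul hA hB, ?_⟩⟩
  push_cast
  rw [div_sub_div _ _ hA0 hB0]
  ring

include hp hp3 in
theorem padicDvd_cubicTerm_sub {k : ℕ} (hk : k < p) :
    PadicDvd p 2 (cubicTerm 0 k - cubicTerm p k) := by
  have h := (PadicDvd.prod_sub_prod (m := 2) hp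
    (f := fun i => ((2 * (i : ℚ) + 1) ^ 2 - 0 ^ 2) / (36 * (i + 1) ^ 2 - 0 ^ 2))
    (g := fun i => ((2 * (i : ℚ) + 1) ^ 2 - (p : ℚ) ^ 2) / (36 * (i + 1) ^ 2 - (p : ℚ) ^ 2)) k
    (fun i hi => (padicDvd_factor_sub hp hp3 (by omega)).1)
    (fun i hi => (padicDvd_factor_sub hp hp3 (by omega)).2)).2
  rw [cubicTerm, cubicTerm, ← mul_sub]
  have h1 : PadicDvd p 0 (((8 * k + 1) * (4 * k).choose (2 * k) : ℤ) : ℚ) :=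
    PadicDvd.of_int hp (by simp)
  have h2 := h1.mul hp (padicDvd_inv_two_pow_mul_three_pow hp hp3 (4 * k) 0)
  have h3 := h2.mul hp h
  rw [zero_add, zero_add] at h3
  convert h3 using 2
  rw [normChoose, pow_mul, div_eq_mul_inv]
  norm_num
  ring

include hp hp3 in
theorem sum_cubicTerm_self_sq :
    (∑ k ∈ Finset.range p, cubicTerm p k) ^ 2 = (p : ℚ) ^ 2 := by
  have h2 : ¬ 2 ∣ p := fun h => by
    have := (Nat.prime_dvd_prime_iff_eq Nat.prime_two hp).1 h
    omega
  have h3 : ¬ 3 ∣ p := fun h => by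
    have := (Nat.prime_dvd_prime_iff_eq Nat.prime_three hp).1 h
    omega
  have hp0 : (p : ℚ) ≠ 0 := by exact_mod_cast hp.ne_zero
  have h : (∑ k ∈ Finset.range p, cubicTerm p k) / p = 1 ∨
      (∑ k ∈ Finset.range p, cubicTerm p k) / p = -1 := by
    rcases (by omega : p = 6 * (p / 6) + 1 ∨ p = 6 * (p / 6) + 5) with e | e
    · left
      have := sum_cubicTerm_one_mod_six (p / 6) (K := p) (by omega)
      rwa [← e] at this
    · right
      have := sum_cubicTerm_five_mod_six (p / 6) (K := p) (by omega)
      rwa [← e] at this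
  rw [← div_eq_one_iff_eq (pow_ne_zero 2 hp0), ← div_pow]
  rcases h with h | h <;> simp [h]

include hp hp3 in
theorem padicDvd_sum_cubicTerm_zero_sq_sub :
    PadicDvd p 3 ((∑ k ∈ Finset.range p, cubicTerm 0 k) ^ 2 - (p : ℚ) ^ 2) := by
  have hsq := sum_cubicTerm_self_sq hp hp3
  have hd : PadicDvd p 2
      (∑ k ∈ Finset.range p, cubicTerm 0 k - ∑ k ∈ Finset.range p, cubicTerm p k) := by
    rw [← Finset.sum_sub_distrib]
    exact PadicDvd.sum hp _ fun k hk => padicDvd_cubicTerm_sub hp hp3 (Finset.mem_range.1 hk)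
  have hT : PadicDvd p 1 (∑ k ∈ Finset.range p, cubicTerm p k) := by
    have hpp : PadicDvd p 1 ((p : ℤ) : ℚ) := PadicDvd.of_int hp (by simp)
    rcases sq_eq_sq_iff_eq_or_eq_neg.1 hsq with h | h <;> rw [h]
    · exact hpp
    · exact hpp.neg
  have hs := ((hd.mono one_le_two).add hp hT).add hp hT
  rw [← hsq, sq_sub_sq]
  have := hs.mul hp hd
  convert this using 2
  ring

include hp hp3 in
theorem padicDvd_convolution_sub :
    PadicDvd p 3 (∑ k ∈ Finset.range p, ∑ j ∈ Finset.range (k + 1),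
      cubicTerm 0 j * cubicTerm 0 (k - j) - (∑ k ∈ Finset.range p, cubicTerm 0 k) ^ 2) := by
  rw [Finset.sum_range_diag_flip p fun i j => cubicTerm 0 i * cubicTerm 0 j, sq,
    Finset.sum_mul_sum, ← Finset.sum_sub_distrib]
  refine PadicDvd.sum hp _ fun i hi => ?_
  -- What remains is minus the sum over p - i ≤ j < p.
  rw [← neg_sub, ← Finset.sum_Ico_eq_sub _ (Nat.sub_le p i)]
  refine (PadicDvd.sum hp _ fun j hj => ?_).neg
  rw [Finset.mem_range] at hi
  rw [Finset.mem_Ico] at hj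
  refine ((padicDvd_cubicTerm_zero hp hp3 hi).mul hp
    (padicDvd_cubicTerm_zero hp hp3 hj.2)).mono ?_
  have h1 := Nat.lt_div_mul_add (a := 4 * i) hp.pos
  have h2 := Nat.lt_div_mul_add (a := 4 * j) hp.pos
  -- Since 4i/p + 4j/p ≥ 4 and each floor loses less than 1, the floors add up to more than 2.
  by_contra! hlt
  have : (4 * i / p + 4 * j / p) * p ≤ 2 * p := Nat.mul_le_mul_right p (by omega)
  rw [add_mul] at this
  omega

end Congruence

theorem mainTheorem5 (p : ℕ) (hp : p.Prime) (hp3 : 3 < p) :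
    RatModEq ((p : ℤ) ^ 3)
      (∑ k ∈ Finset.range p,
        (1 : ℚ) / ((2 : ℚ) ^ (8 * k) * (3 : ℚ) ^ (2 * k)) *
          ∑ j ∈ Finset.range (k + 1),
            ((2 * j).choose j : ℚ) ^ 2 * ((4 * j).choose (2 * j) : ℚ) *
              ((2 * k - 2 * j).choose (k - j) : ℚ) ^ 2 *
              ((4 * k - 4 * j).choose (2 * k - 2 * j) : ℚ) *
              (8 * (j : ℚ) + 1) * (8 * (k : ℚ) - 8 * (j : ℚ) + 1))
      ((p : ℚ) ^ 2) := by 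
  have hconv : ∀ k ∈ Finset.range p,
      (1 : ℚ) / ((2 : ℚ) ^ (8 * k) * (3 : ℚ) ^ (2 * k)) *
          ∑ j ∈ Finset.range (k + 1),
            ((2 * j).choose j : ℚ) ^ 2 * ((4 * j).choose (2 * j) : ℚ) *
              ((2 * k - 2 * j).choose (k - j) : ℚ) ^ 2 *
              ((4 * k - 4 * j).choose (2 * k - 2 * j) : ℚ) *
              (8 * (j : ℚ) + 1) * (8 * (k : ℚ) - 8 * (j : ℚ) + 1) =
        ∑ j ∈ Finset.range (k + 1), cubicTerm 0 j * cubicTerm 0 (k - j) := by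
    intro k _
    rw [Finset.mul_sum]
    refine Finset.sum_congr rfl fun j hj => ?_
    obtain ⟨l, rfl⟩ := Nat.exists_eq_add_of_le (Nat.lt_succ_iff.1 (Finset.mem_range.1 hj))
    rw [cubicTerm_zero, cubicTerm_zero, pow_mul, pow_mul, ← mul_pow,
      show 2 * (j + l) - 2 * j = 2 * l by omega, show 4 * (j + l) - 4 * j = 4 * l by omega,
      show j + l - j = l by omega, pow_add]
    norm_num
    field_simp
    ring
  rw [Finset.sum_congr rfl hconv]
  refine PadicDvd.ratModEq hp ?_
  have := (padicDvd_convolution_sub hp hp3).add hp (padicDvd_sum_cubicTerm_zero_sq_sub hp hp3)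
  rwa [sub_add_sub_cancel] at this
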